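/- **Setting.** Consider a sequence of Gaussian linear regression models $\mathbf y = X\beta+\epsilon$, $\epsilon\sim N(0,\sigma^2 I_n)$, with $\sigma>0$ known, $X\in\mathbb R^{n\times p}$ of rank $r$, where $n$, $p$, $X$, $r$ vary along the sequence, $r\to\infty$, and any $r$ columns of $X$ are linearly independent. For each $X$ a set $\Omega$ of admissible models (subsets of $\{1,\dots,p\}$) of sizes at most $r$ is given; $m(k)$ is the number of admissible models of size $k$, and $m(0)=m(r)=1$. Let $\mathfrak M_{p_0}$ be the set of admissible models of size at most $p_0$; $\beta_M$ denotes a vector with $\beta_{M,j}\ne0$ iff $j\in M$. The design is *nearly orthogonal*: $\tau[r]=\phi_{\min}[r]/\phi_{\max}[r]$ is bounded away from zero along the sequence, where $\phi_{\min}[k]$ and $\phi_{\max}[k]$ are the minimum and the maximum of $\|X\beta\|^2/\|\beta\|^2$ over vectors $\beta$ with $1\le\|\beta\|_0\le k$. For $\gamma>0$ and a prior $\pi$ on the model size $\{0,\dots,r\}$ with $\pi(k)=0$ iff $m(k)=0$, the MAP estimator of the mean vector is $X\hat\beta_{\hat M}$, where $\hat\beta_M$ is the least squares estimator for $M$ and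 $\hat M$ minimizes over $M\in\Omega$ $$\|\mathbf y-X\hat\beta_M\|^2+2\sigma^2(1+1/\gamma)\ln\{m(|M|)\,\pi(|M|)^{-1}(1+\gamma)^{|M|/2}\}.$$ Put $c(\gamma)=8(\gamma+3/4)^2$. **Corollary (small numbers of admissible models).** Let the design be nearly orthogonal and $\ln m(k)=O(k)$, uniformly along the sequence, over the sizes $k=1,\dots,r-1$ with $m(k)>0$. 1. There are constants $0<C_1\le C_2<\infty$, not depending on $\sigma$, such that for all sufficiently advanced members of the sequence $$C_1\sigma^2p_0\le\inf_{\tilde{\mathbf y}}\ \sup_{\beta_M:\,M\in\mathfrak M_{p_0}}E\|\tilde{\mathbf y}-X\beta_M\|^2\le C_2\sigma^2p_0$$ for all $p_0=1,\dots,r$ with $m(p_0)>0$; the infimum is over all estimators of the mean vector. 2. For all $\gamma>0$ and $c>0$ there is a constant $C$, not depending on $\sigma$ or on the priors, such that for all sufficiently advanced members of the sequence and every prior with $e^{-ck}\le\pi(k)\le m(k)e^{-c(\gamma)k}$ for all $k=1,\dots,r$ with $m(k)>0$, the maximal risk $\sup_{\beta_M:\,M\in\mathfrak M_{p_0}}E\|X\hat\beta_{\hat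 M}-X\beta_M\|^2$ of the MAP estimator is at most $C$ times the minimax risk in 1, simultaneously for all $p_0=1,\dots,r$ with $m(p_0)>0$. -/

import Mathlib

open MeasureTheory ProbabilityTheory Filter Matrix
open scoped ENNReal

noncomputable section

namespace StructuredRegression

variable {n p : ℕ}

/-- The mean vector `X β ∈ ℝⁿ`, as an element of the Euclidean space. -/
def meanVec (X : Matrix (Fin n) (Fin p) ℝ) (β : EuclideanSpace ℝ (Fin p)) :
    EuclideanSpace ℝ (Fin n) :=
  WithLp.toLp 2 (X *ᵥ WithLp.ofLp β)

/-- The law of the observation `y = X β + ε` with `ε ∼ N(0, σ² Iₙ)`. -/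
def obsLaw (X : Matrix (Fin n) (Fin p) ℝ) (σ : ℝ) (β : EuclideanSpace ℝ (Fin p)) :
    Measure (EuclideanSpace ℝ (Fin n)) :=
  (stdGaussian (EuclideanSpace ℝ (Fin n))).map (fun ε => meanVec X β + σ • ε)

/-- The model of a coefficient vector: the set of indices of its nonzero entries. -/
def supp (β : EuclideanSpace ℝ (Fin p)) : Finset (Fin p) :=
  Finset.univ.filter (fun j => β j ≠ 0)

/-! ### Admissible models

A model is a finite set of predictors, `Ω` is the set of all admissible models. -/

/-- `m(k)`: the number of admissible models of size `k`. -/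
def numModels (Ω : Finset (Finset (Fin p))) (k : ℕ) : ℕ :=
  (Ω.filter (fun M => M.card = k)).card

/-- The standing assumptions on a design `X` of rank `r` and on the admissible models:
any `r` columns of `X` are linearly independent, no admissible model has more than `r`
predictors, the null model is admissible, and the (indistinguishable) models of size `r` are
represented by a single saturated model. -/
structure IsSetting (X : Matrix (Fin n) (Fin p) ℝ) (Ω : Finset (Finset (Fin p))) : Prop where
  linearIndependent : ∀ M : Finset (Fin p), M.card = X.rank →
    LinearIndependent ℝ (fun j : M => X.col j.1)
  card_le : ∀ M ∈ Ω, M.card ≤ X.rank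
  null_mem : ∅ ∈ Ω
  saturated : numModels Ω X.rank = 1

/-- The coefficient vectors `β_M` of the admissible models `M` of size at most `p₀`
(`β_{M,j} ≠ 0` iff `j ∈ M`). -/
def coefSet (Ω : Finset (Finset (Fin p))) (p₀ : ℕ) : Set (EuclideanSpace ℝ (Fin p)) :=
  {β | supp β ∈ Ω ∧ (supp β).card ≤ p₀}

/-! ### Risks -/

/-- The quadratic risk `E‖ỹ - X β‖²` of an estimate `ỹ = est y` of the mean vector. -/
def risk (X : Matrix (Fin n) (Fin p) ℝ) (σ : ℝ)
    (est : EuclideanSpace ℝ (Fin n) → EuclideanSpace ℝ (Fin n))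
    (β : EuclideanSpace ℝ (Fin p)) : ℝ≥0∞ :=
  ∫⁻ y, ENNReal.ofReal (‖est y - meanVec X β‖ ^ 2) ∂(obsLaw X σ β)

/-- The maximal risk of an estimate over the admissible models of size at most `p₀`. -/
def maxRisk (X : Matrix (Fin n) (Fin p) ℝ) (Ω : Finset (Finset (Fin p))) (σ : ℝ) (p₀ : ℕ)
    (est : EuclideanSpace ℝ (Fin n) → EuclideanSpace ℝ (Fin n)) : ℝ≥0∞ :=
  ⨆ β ∈ coefSet Ω p₀, risk X σ est β

/-- The minimax risk over the admissible models of size at most `p₀`; the infimum is over all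
(measurable) estimates of the mean vector. -/
def minimaxRisk (X : Matrix (Fin n) (Fin p) ℝ) (Ω : Finset (Finset (Fin p))) (σ : ℝ) (p₀ : ℕ) :
    ℝ≥0∞ :=
  ⨅ (est : EuclideanSpace ℝ (Fin n) → EuclideanSpace ℝ (Fin n)) (_ : Measurable est),
    maxRisk X Ω σ p₀ est

/-! ### Sparse eigenvalues -/

/-- The values `‖X β‖² / ‖β‖²` over the vectors `β` with `1 ≤ ‖β‖₀ ≤ k`. -/
def sparseQuotients (X : Matrix (Fin n) (Fin p) ℝ) (k : ℕ) : Set ℝ :=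
  (fun β : EuclideanSpace ℝ (Fin p) => ‖meanVec X β‖ ^ 2 / ‖β‖ ^ 2) ''
    {β | 1 ≤ (supp β).card ∧ (supp β).card ≤ k}

/-- The `k`-sparse minimal eigenvalue `φ_min[k]`. -/
def phiMin (X : Matrix (Fin n) (Fin p) ℝ) (k : ℕ) : ℝ := sInf (sparseQuotients X k)

/-- The `k`-sparse maximal eigenvalue `φ_max[k]`. -/
def phiMax (X : Matrix (Fin n) (Fin p) ℝ) (k : ℕ) : ℝ := sSup (sparseQuotients X k)

/-- The sparse eigenvalue ratio `τ[k] = φ_min[k] / φ_max[k]`. -/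
def tau (X : Matrix (Fin n) (Fin p) ℝ) (k : ℕ) : ℝ := phiMin X k / phiMax X k

/-! ### The MAP estimator -/

/-- The least squares coefficients of a model `M` with linearly independent columns:
`(X_MᵀX_M)⁻¹ X_Mᵀ y` on `M` and zero off `M`, where `X_M` is formed by the columns of `X` in `M`.
(This is `(D_M XᵀX D_M)⁺ D_M Xᵀ y` with the diagonal indicator matrix `D_M` of `M`.) -/
def lsCoef (X : Matrix (Fin n) (Fin p) ℝ) (M : Finset (Fin p)) (y : EuclideanSpace ℝ (Fin n)) :
    EuclideanSpace ℝ (Fin p) :=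
  let XM : Matrix (Fin n) M ℝ := X.submatrix id Subtype.val
  WithLp.toLp 2 fun j =>
    if h : j ∈ M then ((XMᵀ * XM)⁻¹ *ᵥ (XMᵀ *ᵥ WithLp.ofLp y)) ⟨j, h⟩ else 0

/-- `π` is a prior on the model size `0, …, r`, which charges exactly the sizes of admissible
models. -/
structure IsSizePrior (Ω : Finset (Finset (Fin p))) (r : ℕ) (π : ℕ → ℝ) : Prop where
  nonneg : ∀ k ≤ r, 0 ≤ π k
  sum_eq_one : ∑ k ∈ Finset.range (r + 1), π k = 1
  eq_zero_iff : ∀ k ≤ r, π k = 0 ↔ numModels Ω k = 0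

/-- The complexity penalty
`Pen(k) = 2 σ² (1 + 1/γ) ln (m(k) π(k)⁻¹ (1 + γ)^{k/2})`. -/
def pen (Ω : Finset (Finset (Fin p))) (π : ℕ → ℝ) (γ σ : ℝ) (k : ℕ) : ℝ :=
  2 * σ ^ 2 * (1 + 1 / γ) *
    Real.log ((numModels Ω k : ℝ) * (π k)⁻¹ * (1 + γ) ^ ((k : ℝ) / 2))

/-- The MAP criterion `‖y - X β̂_M‖² + Pen(|M|)`. -/
def mapCriterion (X : Matrix (Fin n) (Fin p) ℝ) (Ω : Finset (Finset (Fin p))) (π : ℕ → ℝ)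
    (γ σ : ℝ) (y : EuclideanSpace ℝ (Fin n)) (M : Finset (Fin p)) : ℝ :=
  ‖y - meanVec X (lsCoef X M y)‖ ^ 2 + pen Ω π γ σ M.card

/-- `Mhat` is a MAP model selector: a (measurable) choice, for every `y`, of an admissible model
that minimizes the MAP criterion. -/
structure IsMAPSelector (X : Matrix (Fin n) (Fin p) ℝ) (Ω : Finset (Finset (Fin p))) (π : ℕ → ℝ)
    (γ σ : ℝ) (Mhat : EuclideanSpace ℝ (Fin n) → Finset (Fin p)) : Prop where
  measurableSet_fiber : ∀ M, MeasurableSet {y | Mhat y = M}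
  mem : ∀ y, Mhat y ∈ Ω
  le : ∀ y, ∀ M ∈ Ω, mapCriterion X Ω π γ σ y (Mhat y) ≤ mapCriterion X Ω π γ σ y M

/-- The estimate `X β̂_{M̂}` of the mean vector, for a model selector `M̂`. -/
def selectedEstimate (X : Matrix (Fin n) (Fin p) ℝ)
    (Mhat : EuclideanSpace ℝ (Fin n) → Finset (Fin p)) (y : EuclideanSpace ℝ (Fin n)) :
    EuclideanSpace ℝ (Fin n) :=
  meanVec X (lsCoef X (Mhat y) y)

/-- `c(γ) = 8 (γ + 3/4)²`. -/
def cGamma (γ : ℝ) : ℝ := 8 * (γ + 3 / 4) ^ 2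

/-! ### Sequences of designs -/

/-- A sequence of designs is nearly orthogonal if the sparse eigenvalue ratios `τ[r]`,
`r = rank X`, are bounded away from zero. -/
def NearlyOrthogonal {n p : ℕ → ℕ} (X : ∀ t, Matrix (Fin (n t)) (Fin (p t)) ℝ) : Prop :=
  ∃ τ₀ : ℝ, 0 < τ₀ ∧ ∀ᶠ t in atTop, τ₀ ≤ tau (X t) (X t).rank

/-- Small numbers of admissible models: `ln m(k) = O(k)`, `k = 1, …, r - 1`, uniformly along the
sequence. Sizes `k` with `m(k) = 0` are not restricted (`Real.log 0 = 0`). -/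
def SmallNumbers {n p : ℕ → ℕ} (X : ∀ t, Matrix (Fin (n t)) (Fin (p t)) ℝ)
    (Ω : ∀ t, Finset (Finset (Fin (p t)))) : Prop :=
  ∃ A : ℝ, ∀ᶠ t in atTop, ∀ k : ℕ, 1 ≤ k → k < (X t).rank →
    Real.log (numModels (Ω t) k) ≤ A * k

end StructuredRegression

end

/-! Everything is compared with `σ² p₀`. The minimax risk and the maximal risk of the MAP estimator
are both bounded by multiples of it, and the ratio of the two bounds gives part 2.

Lower bound (`IsSetting.le_maxRisk`). Any `r` columns are independent, so an admissible model of
size `p₀` spans a `p₀`-dimensional space of means. It contains a hypercube of means with edges `2σ`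
along an orthonormal basis. Means at distance `2σ` cannot be told apart reliably
(`two_point_bound`), so each coordinate costs a fixed multiple of `σ²`, and averaging over the
vertices adds up these costs (`hypercube_sum_bound`).

Upper bounds. Both come from one oracle inequality for penalized least squares,
`IsSetting.risk_selectedEstimate_le`. The noise acts only through its projection on the sum of the
selected and the true model space. The exponential moment of that chi-squared variable is at most `s
^ |M| * s ^ |M₀|`, and a Kraft sum over the models absorbs the random choice of `M`. The resulting
risk is of the order of the penalty of the true model plus `σ² (|M₀| + 1)`. For the minimax bound
the penalty is constant over models of size at most `p₀`; the Kraft sum then counts models, and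
there are only `exp (O(p₀))` of them. For the MAP penalty, the prior's upper bound makes each Kraft
term at most `π(k) / m(k)`, so the sum is at most the total prior mass. The prior's lower bound and
`ln m(k) = O(k)` keep the penalty `O(σ² k)`. -/

noncomputable section

namespace StructuredRegression

/-! ### Gaussian vectors: chi-squared exponential moments and the two-point bound. -/

section Gaussian

variable {E : Type*} [NormedAddCommGroup E] [InnerProductSpace ℝ E] [FiniteDimensional ℝ E]
  [MeasurableSpace E] [BorelSpace E]

/-- The orthogonal projection of a standard Gaussian vector is standard Gaussian. -/
lemma map_orthogonalProjectionOnto_stdGaussian (V : Submodule ℝ E) :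
    (stdGaussian E).map (fun x => V.orthogonalProjectionOnto x) = stdGaussian V := by
  have : IsProbabilityMeasure ((stdGaussian E).map (fun x => V.orthogonalProjectionOnto x)) :=
    Measure.isProbabilityMeasure_map (by fun_prop)
  apply Measure.ext_of_charFun
  ext t
  rw [charFun_stdGaussian, charFun_apply, integral_map (by fun_prop)
    (Measurable.aestronglyMeasurable (by fun_prop))]
  have h := charFun_stdGaussian (E := E) (t : E)
  rw [charFun_apply] at h
  simp_rw [Submodule.inner_orthogonalProjectionOnto_eq_of_mem_right]
  exact h

/-- The factor turns the standard normal density into an unnormalized centred one with variance `1 /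
(1 - b)`, hence the restriction on `b`. -/
lemma gaussian_exp_mul_sq {b : ℝ} (hb : b < 1) :
    Integrable (fun x : ℝ => Real.exp (b / 2 * x ^ 2)) (gaussianReal 0 1) ∧
    ∫ x, Real.exp (b / 2 * x ^ 2) ∂(gaussianReal 0 1) = (√(1 - b))⁻¹ := by
  have hb' : 0 < (1 - b) / 2 := by linarith
  have key : ∀ x : ℝ, gaussianPDFReal 0 1 x * Real.exp (b / 2 * x ^ 2) =
      (√(2 * Real.pi))⁻¹ * Real.exp (-((1 - b) / 2) * x ^ 2) := by
    intro x
    rw [gaussianPDFReal, mul_assoc, ← Real.exp_add, NNReal.coe_one, mul_one]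
    congr 2
    ring
  constructor
  · rw [gaussianReal_of_var_ne_zero _ one_ne_zero, gaussianPDF_def,
      integrable_withDensity_iff_integrable_smul₀' (by fun_prop) (by simp)]
    refine ((integrable_exp_neg_mul_sq hb').const_mul (√(2 * Real.pi))⁻¹).congr ?_
    filter_upwards with x
    rw [ENNReal.toReal_ofReal (gaussianPDFReal_nonneg _ _ _), smul_eq_mul, key]
  · rw [integral_gaussianReal_eq_integral_smul one_ne_zero]
    simp_rw [smul_eq_mul, key]
    rw [integral_const_mul, integral_gaussian, ← Real.sqrt_inv, ← Real.sqrt_inv,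
      ← Real.sqrt_mul (by positivity)]
    congr 1
    field_simp

/-- The Laplace transform of a chi-squared variable with `dim V` degrees of freedom. -/
lemma lintegral_exp_norm_orthogonalProjectionOnto_sq (V : Submodule ℝ E) {b : ℝ} (hb : b < 1) :
    ∫⁻ x, ENNReal.ofReal (Real.exp (b / 2 * ‖V.orthogonalProjectionOnto x‖ ^ 2)) ∂(stdGaussian E) =
      ENNReal.ofReal ((√(1 - b))⁻¹ ^ Module.finrank ℝ V) := by
  have h1 : ∫⁻ x, ENNReal.ofReal (Real.exp (b / 2 * ‖V.orthogonalProjectionOnto x‖ ^ 2))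
      ∂(stdGaussian E) = ∫⁻ v, ENNReal.ofReal (Real.exp (b / 2 * ‖v‖ ^ 2)) ∂(stdGaussian V) := by
    rw [← map_orthogonalProjectionOnto_stdGaussian, lintegral_map (by fun_prop) (by fun_prop)]
  have h2 : ∀ x : Fin (Module.finrank ℝ V) → ℝ,
      Real.exp (b / 2 * ‖∑ i, x i • stdOrthonormalBasis ℝ V i‖ ^ 2) =
        ∏ i, Real.exp (b / 2 * x i ^ 2) := by
    intro x
    rw [← Real.exp_sum, ← Finset.mul_sum, ← (stdOrthonormalBasis ℝ V).sum_sq_inner_right]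
    simp_rw [(stdOrthonormalBasis ℝ V).orthonormal.inner_right_fintype]
  obtain ⟨hi, he⟩ := gaussian_exp_mul_sq hb
  rw [h1, stdGaussian, lintegral_map (by fun_prop) (by fun_prop)]
  simp_rw [h2]
  rw [← ofReal_integral_eq_lintegral_ofReal, integral_fintype_prod_eq_pow
    (f := fun x : ℝ => Real.exp (b / 2 * x ^ 2)), he, Fintype.card_fin]
  · exact Integrable.fintype_prod (f := fun _ (x : ℝ) => Real.exp (b / 2 * x ^ 2)) fun _ => hi
  · filter_upwards with x
    positivity

/-- A standard Gaussian vector is the sum of its component along a unit vector, which is standard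
normal, and an independent remainder. -/
lemma lintegral_stdGaussian_eq_lintegral_direction {e : E} (he : ‖e‖ = 1) {F : E → ℝ≥0∞}
    (hF : Measurable F) :
    ∫⁻ x, F x ∂(stdGaussian E) =
      ∫⁻ z, ∫⁻ g, F (g • e + (z - inner ℝ e z • e)) ∂(gaussianReal 0 1) ∂(stdGaussian E) := by
  have hee : inner ℝ e e = (1 : ℝ) := by rw [real_inner_self_eq_norm_sq, he]; norm_num
  have hmeas : Measurable fun q : E × ℝ => q.2 • e + (q.1 - inner ℝ e q.1 • e) := by fun_prop
  have hmap : ((stdGaussian E).prod (gaussianReal 0 1)).map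
      (fun q : E × ℝ => q.2 • e + (q.1 - inner ℝ e q.1 • e)) = stdGaussian E := by
    have : IsProbabilityMeasure (((stdGaussian E).prod (gaussianReal 0 1)).map
      (fun q : E × ℝ => q.2 • e + (q.1 - inner ℝ e q.1 • e))) :=
      Measure.isProbabilityMeasure_map (by fun_prop)
    apply Measure.ext_of_charFun
    ext t
    rw [charFun_stdGaussian, charFun_apply, integral_map (by fun_prop)
      (Measurable.aestronglyMeasurable (by fun_prop))]
    have h1 := charFun_stdGaussian (E := E) (t - inner ℝ e t • e)
    have h2 := charFun_gaussianReal (μ := 0) (v := 1) (inner ℝ e t)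
    rw [charFun_apply] at h1
    rw [charFun_apply_real] at h2
    have h3 : ∀ q : E × ℝ, Complex.exp
        ((inner ℝ (q.2 • e + (q.1 - inner ℝ e q.1 • e)) t : ℝ) * Complex.I) =
        Complex.exp ((inner ℝ q.1 (t - inner ℝ e t • e) : ℝ) * Complex.I) *
        Complex.exp ((inner ℝ e t : ℝ) * q.2 * Complex.I) := by
      intro q
      rw [← Complex.exp_add, ← add_mul]
      congr 2
      simp only [inner_add_left, inner_sub_left, inner_sub_right, inner_smul_left,
        inner_smul_right, real_inner_comm e q.1]
      push_cast
      simp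
      ring
    simp_rw [h3]
    rw [integral_prod_mul (fun x : E => Complex.exp
      ((inner ℝ x (t - inner ℝ e t • e) : ℝ) * Complex.I))
      (fun x : ℝ => Complex.exp ((inner ℝ e t : ℝ) * x * Complex.I)), h1, h2, ← Complex.exp_add]
    -- Pythagoras: the exponents of the two characteristic functions add up to that of `t`.
    have h4 : ‖t - inner ℝ e t • e‖ ^ 2 = ‖t‖ ^ 2 - (inner ℝ e t) ^ 2 := by
      rw [← real_inner_self_eq_norm_sq, ← real_inner_self_eq_norm_sq]
      simp only [inner_sub_left, inner_sub_right, inner_smul_left, inner_smul_right, hee,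
        real_inner_comm e t]
      simp
      ring
    congr 1
    rw [← Complex.ofReal_pow, h4]
    push_cast
    simp
    ring
  conv_lhs => rw [← hmap]
  rw [lintegral_map hF hmeas,
    lintegral_prod (fun q : E × ℝ => F (q.2 • e + (q.1 - inner ℝ e q.1 • e)))
    (hF.comp hmeas).aemeasurable]

lemma gaussianPDFReal_two_le {μ x : ℝ} (h : |x - μ| ≤ 2) :
    gaussianPDFReal 0 1 2 ≤ gaussianPDFReal μ 1 x := by
  have h4 : (x - μ) ^ 2 ≤ 2 ^ 2 := sq_le_sq.2 (by simpa using h)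
  simp only [gaussianPDFReal]
  refine mul_le_mul_of_nonneg_left (Real.exp_le_exp.2 ?_) (by positivity)
  simpa using div_le_div_of_nonneg_right (neg_le_neg h4) zero_le_two

/-- No estimate from a normal observation with unit variance separates the means `1` and `-1`. -/
lemma two_point_bound_real {h : ℝ → ℝ} (hh : Measurable h) :
    ENNReal.ofReal (2 * gaussianPDFReal 0 1 2) ≤
      ∫⁻ x, ENNReal.ofReal ((h (1 + x) - 1) ^ 2) ∂(gaussianReal 0 1) +
      ∫⁻ x, ENNReal.ofReal ((h (-1 + x) + 1) ^ 2) ∂(gaussianReal 0 1) := by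
  -- On `[0, 1]` the densities with means `1` and `-1` are both at least the standard density at
  -- `2`; the rest of the line is discarded.
  have shift : ∀ (μ : ℝ) (k : ℝ → ℝ), Measurable k → (∀ x ∈ Set.Icc (0 : ℝ) 1, |x - μ| ≤ 2) →
      ∫⁻ x in Set.Icc (0 : ℝ) 1, ENNReal.ofReal (gaussianPDFReal 0 1 2 * (k x) ^ 2) ≤
      ∫⁻ x, ENNReal.ofReal ((k (μ + x)) ^ 2) ∂(gaussianReal 0 1) := by
    intro μ k hk hμ
    have h1 : ∫⁻ x, ENNReal.ofReal ((k (μ + x)) ^ 2) ∂(gaussianReal 0 1) =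
        ∫⁻ x, ENNReal.ofReal ((k x) ^ 2) ∂(gaussianReal μ 1) := by
      have := gaussianReal_map_const_add (μ := 0) (v := 1) μ
      rw [zero_add] at this
      rw [← this, lintegral_map (by fun_prop) (by fun_prop)]
    rw [h1, gaussianReal_of_var_ne_zero _ one_ne_zero,
      lintegral_withDensity_eq_lintegral_mul _ (measurable_gaussianPDF _ _) (by fun_prop)]
    refine (setLIntegral_mono (by fun_prop) fun x hx => ?_).trans (setLIntegral_le_lintegral _ _)
    simp only [Pi.mul_apply, gaussianPDF]
    rw [← ENNReal.ofReal_mul (gaussianPDFReal_nonneg _ _ _)]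
    gcongr
    exact gaussianPDFReal_two_le (hμ x hx)
  refine le_trans ?_ (add_le_add
    (shift 1 (fun x => h x - 1) (by fun_prop) ?_) (shift (-1) (fun x => h x + 1) (by fun_prop) ?_))
  · rw [← lintegral_add_left (by fun_prop)]
    calc ENNReal.ofReal (2 * gaussianPDFReal 0 1 2)
        = ∫⁻ _ in Set.Icc (0 : ℝ) 1, ENNReal.ofReal (2 * gaussianPDFReal 0 1 2) := by simp
      _ ≤ _ := by
        refine lintegral_mono fun x => ?_
        have hp := gaussianPDFReal_nonneg 0 1 2
        rw [← ENNReal.ofReal_add (by positivity) (by positivity)]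
        gcongr
        -- This rests on `(h - 1)² + (h + 1)² = 2 h² + 2 ≥ 2`.
        nlinarith [mul_nonneg hp (sq_nonneg (h x))]
  · rintro x ⟨h0, h1⟩
    rw [abs_le]; constructor <;> linarith
  · rintro x ⟨h0, h1⟩
    rw [abs_le]; constructor <;> linarith

/-- No estimate of a linear functional separates the Gaussian shifts by `w + σ e` and `w - σ e`. -/
lemma two_point_bound {e : E} (he : ‖e‖ = 1) {σ : ℝ} (hσ : 0 < σ) {f : E → ℝ} (hf : Measurable f)
    (w : E) (c : ℝ) :
    ENNReal.ofReal (2 * gaussianPDFReal 0 1 2 * σ ^ 2) ≤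
      ∫⁻ x, ENNReal.ofReal ((f (w + σ • e + σ • x) - (c + σ)) ^ 2) ∂(stdGaussian E) +
      ∫⁻ x, ENNReal.ofReal ((f (w - σ • e + σ • x) - (c - σ)) ^ 2) ∂(stdGaussian E) := by
  rw [lintegral_stdGaussian_eq_lintegral_direction he
      (F := fun x => ENNReal.ofReal ((f (w + σ • e + σ • x) - (c + σ)) ^ 2)) (by fun_prop),
    lintegral_stdGaussian_eq_lintegral_direction he
      (F := fun x => ENNReal.ofReal ((f (w - σ • e + σ • x) - (c - σ)) ^ 2)) (by fun_prop),
    ← lintegral_add_left (by fun_prop)]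
  calc ENNReal.ofReal (2 * gaussianPDFReal 0 1 2 * σ ^ 2)
      = ∫⁻ _, ENNReal.ofReal (2 * gaussianPDFReal 0 1 2 * σ ^ 2) ∂(stdGaussian E) := by simp
    _ ≤ _ := by
      refine lintegral_mono fun z => ?_
      -- With the remainder of `z` orthogonal to `e` frozen, centring at `c` and dividing by `σ`
      -- leaves a scalar problem with means `1` and `-1`.
      have key := two_point_bound_real
        (h := fun x => (f (w + σ • (x • e) + σ • (z - inner ℝ e z • e)) - c) / σ) (by fun_prop)
      rw [mul_comm, ENNReal.ofReal_mul (by positivity)]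
      refine (mul_le_mul_right key _).trans (le_of_eq ?_)
      rw [mul_add, ← lintegral_const_mul _ (by fun_prop), ← lintegral_const_mul _ (by fun_prop)]
      congr 1 <;> refine lintegral_congr fun g => ?_ <;>
        rw [← ENNReal.ofReal_mul (by positivity), ← mul_pow]
      · rw [mul_sub, mul_div_cancel₀ _ hσ.ne', show w + σ • (1 + g) • e +
          σ • (z - inner ℝ e z • e) = w + σ • e + σ • (g • e + (z - inner ℝ e z • e)) by module]
        ring_nf
      · rw [mul_add, mul_div_cancel₀ _ hσ.ne', show w + σ • (-1 + g) • e +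
          σ • (z - inner ℝ e z • e) = w - σ • e + σ • (g • e + (z - inner ℝ e z • e)) by module]
        ring_nf

end Gaussian

variable {n p : ℕ}

/-! ### Model spaces and least squares as orthogonal projection. -/

section LeastSquares

/-- The mean vector as a linear function of the coefficients. -/
def meanVecLin (X : Matrix (Fin n) (Fin p) ℝ) :
    EuclideanSpace ℝ (Fin p) →ₗ[ℝ] EuclideanSpace ℝ (Fin n) where
  toFun := meanVec X
  map_add' β β' := by simp [meanVec, mulVec_add]
  map_smul' a β := by simp [meanVec, mulVec_smul]

lemma meanVecLin_apply (X : Matrix (Fin n) (Fin p) ℝ) (β : EuclideanSpace ℝ (Fin p)) :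
    meanVecLin X β = meanVec X β := rfl

/-- Extension by zero of a coefficient vector on the model `M`. -/
def coefExt (M : Finset (Fin p)) : (M → ℝ) →ₗ[ℝ] EuclideanSpace ℝ (Fin p) where
  toFun v := WithLp.toLp 2 fun j => if h : j ∈ M then v ⟨j, h⟩ else 0
  map_add' v w := by ext j; by_cases h : j ∈ M <;> simp [h]
  map_smul' a v := by ext j; by_cases h : j ∈ M <;> simp [h]

lemma coefExt_apply_mem {M : Finset (Fin p)} (v : M → ℝ) {j : Fin p} (h : j ∈ M) :
    coefExt M v j = v ⟨j, h⟩ := by simp [coefExt, h]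

lemma coefExt_apply_notMem {M : Finset (Fin p)} (v : M → ℝ) {j : Fin p} (h : j ∉ M) :
    coefExt M v j = 0 := by simp [coefExt, h]

lemma coefExt_restrict {M : Finset (Fin p)} {β : EuclideanSpace ℝ (Fin p)} (h : supp β ⊆ M) :
    coefExt M (fun j => β j) = β := by
  ext j
  by_cases hj : j ∈ M
  · rw [coefExt_apply_mem _ hj]
  · rw [coefExt_apply_notMem _ hj]
    by_contra h0
    exact hj (h (by simpa [supp] using Ne.symm h0))

/-- The space of the mean vectors of a model. -/
def modelSpace (X : Matrix (Fin n) (Fin p) ℝ) (M : Finset (Fin p)) :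
    Submodule ℝ (EuclideanSpace ℝ (Fin n)) :=
  LinearMap.range (meanVecLin X ∘ₗ coefExt M)

lemma meanVec_coefExt (X : Matrix (Fin n) (Fin p) ℝ) (M : Finset (Fin p)) (v : M → ℝ) :
    meanVec X (coefExt M v) =
      WithLp.toLp 2 ((X.submatrix id Subtype.val : Matrix (Fin n) M ℝ) *ᵥ v) := by
  refine congrArg (WithLp.toLp 2) (funext fun i => ?_)
  change ∑ j, X i j * coefExt M v j = ∑ j : M, X i j * v j
  rw [← Finset.sum_subset (Finset.subset_univ M), ← Finset.sum_coe_sort M]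
  · exact Finset.sum_congr rfl fun j _ => by rw [coefExt_apply_mem v j.2]
  · intro j _ hj
    rw [coefExt_apply_notMem v hj, mul_zero]

lemma meanVec_mem_modelSpace (X : Matrix (Fin n) (Fin p) ℝ) {M : Finset (Fin p)}
    {β : EuclideanSpace ℝ (Fin p)} (h : supp β ⊆ M) : meanVec X β ∈ modelSpace X M :=
  ⟨fun j => β j, by rw [LinearMap.comp_apply, coefExt_restrict h, meanVecLin_apply]⟩

lemma finrank_modelSpace_le (X : Matrix (Fin n) (Fin p) ℝ) (M : Finset (Fin p)) :
    Module.finrank ℝ (modelSpace X M) ≤ M.card := by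
  exact (LinearMap.finrank_range_le (meanVecLin X ∘ₗ coefExt M)).trans (by simp)

lemma meanVec_lsCoef_mem_modelSpace (X : Matrix (Fin n) (Fin p) ℝ) (M : Finset (Fin p))
    (y : EuclideanSpace ℝ (Fin n)) : meanVec X (lsCoef X M y) ∈ modelSpace X M :=
  ⟨_, rfl⟩

/-- A smaller model extends to a set of exactly `r` columns, and independence passes to subfamilies.
-/
lemma IsSetting.mulVec_injective {X : Matrix (Fin n) (Fin p) ℝ} {Ω : Finset (Finset (Fin p))}
    (h : IsSetting X Ω) {M : Finset (Fin p)} (hM : M.card ≤ X.rank) :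
    Function.Injective (X.submatrix id Subtype.val : Matrix (Fin n) M ℝ).mulVec := by
  rw [mulVec_injective_iff]
  obtain ⟨N, hMN, hN⟩ := Finset.exists_superset_card_eq hM (by simpa using X.rank_le_width)
  have hinj : Function.Injective (fun j : M => (⟨j.1, hMN j.2⟩ : N)) := fun i j hij =>
    Subtype.ext (congrArg (fun k : N => k.1) hij)
  exact (h.linearIndependent N hN).comp _ hinj

lemma IsSetting.finrank_modelSpace {X : Matrix (Fin n) (Fin p) ℝ} {Ω : Finset (Finset (Fin p))}
    (h : IsSetting X Ω) {M : Finset (Fin p)} (hM : M.card ≤ X.rank) :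
    Module.finrank ℝ (modelSpace X M) = M.card := by
  have hinj : Function.Injective (meanVecLin X ∘ₗ coefExt M) := fun v w hvw =>
    h.mulVec_injective hM (WithLp.toLp_injective 2 (by
      rwa [LinearMap.comp_apply, LinearMap.comp_apply, meanVecLin_apply, meanVecLin_apply,
        meanVec_coefExt, meanVec_coefExt] at hvw))
  exact (LinearMap.finrank_range_of_inj hinj).trans (by simp)

/-- The normal equations. -/
lemma IsSetting.inner_residual_eq_zero {X : Matrix (Fin n) (Fin p) ℝ}
    {Ω : Finset (Finset (Fin p))} (h : IsSetting X Ω) {M : Finset (Fin p)} (hM : M.card ≤ X.rank)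
    (y : EuclideanSpace ℝ (Fin n)) {v : EuclideanSpace ℝ (Fin n)} (hv : v ∈ modelSpace X M) :
    inner ℝ (y - meanVec X (lsCoef X M y)) v = 0 := by
  obtain ⟨u, rfl⟩ := hv
  rw [LinearMap.comp_apply, meanVecLin_apply, meanVec_coefExt]
  set A : Matrix (Fin n) M ℝ := X.submatrix id Subtype.val with hA
  have hpd : (Aᵀ * A).PosDef := by
    simpa using Matrix.PosDef.conjTranspose_mul_self A (h.mulVec_injective hM)
  have hls : meanVec X (lsCoef X M y) =
      WithLp.toLp 2 (A *ᵥ ((Aᵀ * A)⁻¹ *ᵥ (Aᵀ *ᵥ WithLp.ofLp y))) :=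
    meanVec_coefExt X M _
  have hnormal : Aᵀ *ᵥ (A *ᵥ ((Aᵀ * A)⁻¹ *ᵥ (Aᵀ *ᵥ WithLp.ofLp y))) =
      Aᵀ *ᵥ WithLp.ofLp y := by
    rw [mulVec_mulVec, mulVec_mulVec, Matrix.mul_nonsing_inv _
      ((Matrix.isUnit_iff_isUnit_det _).1 hpd.isUnit), one_mulVec]
  rw [hls, EuclideanSpace.inner_eq_star_dotProduct]
  simp only [WithLp.ofLp_sub, star_trivial]
  rw [dotProduct_comm, dotProduct_mulVec, ← mulVec_transpose, mulVec_sub, hnormal, sub_self,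
    zero_dotProduct]

lemma IsSetting.norm_residual_le {X : Matrix (Fin n) (Fin p) ℝ} {Ω : Finset (Finset (Fin p))}
    (h : IsSetting X Ω) {M : Finset (Fin p)} (hM : M.card ≤ X.rank)
    (y : EuclideanSpace ℝ (Fin n)) {v : EuclideanSpace ℝ (Fin n)} (hv : v ∈ modelSpace X M) :
    ‖y - meanVec X (lsCoef X M y)‖ ^ 2 ≤ ‖y - v‖ ^ 2 := by
  have h1 : y - v = (y - meanVec X (lsCoef X M y)) + (meanVec X (lsCoef X M y) - v) := by abel
  rw [h1, norm_add_sq_real, h.inner_residual_eq_zero hM y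
    ((modelSpace X M).sub_mem (meanVec_lsCoef_mem_modelSpace X M y) hv)]
  nlinarith [sq_nonneg ‖meanVec X (lsCoef X M y) - v‖]

lemma measurable_meanVec_lsCoef (X : Matrix (Fin n) (Fin p) ℝ) (M : Finset (Fin p)) :
    Measurable fun y => meanVec X (lsCoef X M y) := by
  have : (fun y => meanVec X (lsCoef X M y)) = fun y =>
      WithLp.toLp 2 ((X.submatrix id Subtype.val : Matrix (Fin n) M ℝ) *ᵥ
        (((X.submatrix id Subtype.val : Matrix (Fin n) M ℝ)ᵀ *
          (X.submatrix id Subtype.val : Matrix (Fin n) M ℝ))⁻¹ *ᵥ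
        ((X.submatrix id Subtype.val : Matrix (Fin n) M ℝ)ᵀ *ᵥ WithLp.ofLp y))) :=
    funext fun y => meanVec_coefExt X M _
  rw [this]
  exact Continuous.measurable (by fun_prop)

lemma measurable_selectedEstimate (X : Matrix (Fin n) (Fin p) ℝ)
    {Mhat : EuclideanSpace ℝ (Fin n) → Finset (Fin p)}
    (hM : ∀ M, MeasurableSet {y | Mhat y = M}) : Measurable (selectedEstimate X Mhat) := by
  have h : selectedEstimate X Mhat = fun y =>
      ∑ M, {y | Mhat y = M}.indicator (fun y => meanVec X (lsCoef X M y)) y := by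
    funext y
    rw [Finset.sum_eq_single (Mhat y)]
    · rw [Set.indicator_of_mem (by simp), selectedEstimate]
    · intro M _ hne
      exact Set.indicator_of_notMem (fun h => hne h.symm) _
    · simp
  rw [h]
  exact Finset.measurable_sum _ fun M _ => (measurable_meanVec_lsCoef X M).indicator (hM M)

lemma lintegral_obsLaw (X : Matrix (Fin n) (Fin p) ℝ) (σ : ℝ) (β : EuclideanSpace ℝ (Fin p))
    (F : EuclideanSpace ℝ (Fin n) → ℝ≥0∞) (hF : Measurable F) :
    ∫⁻ y, F y ∂(obsLaw X σ β) =
      ∫⁻ x, F (meanVec X β + σ • x) ∂(stdGaussian (EuclideanSpace ℝ (Fin n))) := by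
  rw [obsLaw, lintegral_map hF (by fun_prop)]

end LeastSquares

/-! ### The minimax lower bound by a hypercube of means. -/

section LowerBound

/-- Averaging over the hypercube of a quantity that is bounded below on its edges. -/
lemma hypercube_sum_bound {ι : Type*} [Fintype ι] [DecidableEq ι] (D : ι → (ι → Bool) → ℝ≥0∞)
    {K : ℝ≥0∞}
    (hD : ∀ i s, K ≤ D i (Function.update s i true) + D i (Function.update s i false)) :
    Fintype.card (ι → Bool) * (Fintype.card ι * K) ≤ 2 * ∑ s, ∑ i, D i s := by
  have hinv : ∀ i : ι,
      Function.Involutive fun s : ι → Bool => Function.update s i (!s i) := by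
    intro i s
    simp
  have key : ∀ i, Fintype.card (ι → Bool) * K ≤ 2 * ∑ s, D i s := by
    intro i
    calc (Fintype.card (ι → Bool) : ℝ≥0∞) * K = ∑ _s : ι → Bool, K := by
          rw [Finset.sum_const, Finset.card_univ, nsmul_eq_mul]
      -- Each vertex is paired with its neighbour across coordinate `i`; flipping is an involution,
      -- so every vertex is counted twice.
      _ ≤ ∑ s, (D i s + D i (Function.update s i (!s i))) := by
          refine Finset.sum_le_sum fun s _ => ?_
          have h := hD i s
          rcases hs : s i with _ | _
          · rw [← hs, Function.update_eq_self, add_comm] at h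
            simpa [hs] using h
          · nth_rewrite 1 [← hs] at h
            rw [Function.update_eq_self] at h
            simpa [hs] using h
      _ = 2 * ∑ s, D i s := by
          rw [Finset.sum_add_distrib, two_mul]
          congr 1
          exact Equiv.sum_comp (hinv i).toPerm (fun s => D i s)
  calc (Fintype.card (ι → Bool) : ℝ≥0∞) * (Fintype.card ι * K)
      = ∑ _i : ι, Fintype.card (ι → Bool) * K := by
        rw [Finset.sum_const, Finset.card_univ, nsmul_eq_mul]
        ring
    _ ≤ ∑ i, 2 * ∑ s, D i s := Finset.sum_le_sum fun i _ => key i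
    _ = 2 * ∑ s, ∑ i, D i s := by rw [← Finset.mul_sum, Finset.sum_comm]

/-- Every estimate has maximal risk of order at least `σ² |M|` for an admissible model `M`. -/
lemma IsSetting.le_maxRisk {X : Matrix (Fin n) (Fin p) ℝ} {Ω : Finset (Finset (Fin p))}
    (h : IsSetting X Ω) {M : Finset (Fin p)} (hM : M ∈ Ω) {σ : ℝ} (hσ : 0 < σ)
    {est : EuclideanSpace ℝ (Fin n) → EuclideanSpace ℝ (Fin n)} (hest : Measurable est) :
    ENNReal.ofReal (gaussianPDFReal 0 1 2 * (σ ^ 2 * M.card)) ≤ maxRisk X Ω σ M.card est := by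
  set d := Module.finrank ℝ (modelSpace X M) with hd
  have hdM : d = M.card := h.finrank_modelSpace (h.card_le M hM)
  let b := stdOrthonormalBasis ℝ (modelSpace X M)
  have hb : Orthonormal ℝ (fun i => (b i : EuclideanSpace ℝ (Fin n))) :=
    b.orthonormal.comp_linearIsometry (modelSpace X M).subtypeₗᵢ
  generalize he : (fun i => (b i : EuclideanSpace ℝ (Fin n))) = e at hb
  have hu : ∀ i, ∃ u : M → ℝ, meanVec X (coefExt M u) = e i := fun i => by
    obtain ⟨u, hu⟩ := (b i).2
    exact ⟨u, by rw [← he]; exact hu⟩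
  choose u hu using hu
  let sgn : Bool → ℝ := fun a => if a then 1 else -1
  -- The centre `T` exceeds every possible perturbation of a coefficient, so all coefficients on `M`
  -- stay positive and each vertex has support exactly `M`, as `coefSet` requires.
  let T : ℝ := 1 + ∑ i, σ * ∑ j, |u i j|
  let β : (Fin d → Bool) → EuclideanSpace ℝ (Fin p) := fun s =>
    coefExt M ((fun _ => T) + ∑ i, (σ * sgn (s i)) • u i)
  have hcoef : ∀ (s : Fin d → Bool) (j : M),
      ((fun _ => T) + ∑ i, (σ * sgn (s i)) • u i : M → ℝ) j ≠ 0 := by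
    intro s j
    apply ne_of_gt
    have h1 : -∑ i, σ * ∑ j, |u i j| ≤ ∑ i, ((σ * sgn (s i)) • u i) j := by
      rw [← Finset.sum_neg_distrib]
      refine Finset.sum_le_sum fun i _ => ?_
      rw [Pi.smul_apply, smul_eq_mul, mul_assoc, ← mul_neg]
      refine mul_le_mul_of_nonneg_left ?_ hσ.le
      have h2 : |u i j| ≤ ∑ j, |u i j| :=
        Finset.single_le_sum (f := fun j => |u i j|) (fun _ _ => abs_nonneg _) (Finset.mem_univ j)
      have h3 : -|u i j| ≤ sgn (s i) * u i j := by
        rcases s i with _ | _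
        · simpa [sgn] using le_abs_self (u i j)
        · simpa [sgn] using neg_abs_le (u i j)
      linarith
    rw [Pi.add_apply, Finset.sum_apply]
    linarith
  have hsupp : ∀ s, supp (β s) = M := by
    intro s
    ext j
    simp only [supp, Finset.mem_filter, Finset.mem_univ, true_and]
    by_cases hj : j ∈ M
    · simp only [hj, iff_true, β]
      rw [coefExt_apply_mem _ hj]
      exact hcoef s ⟨j, hj⟩
    · simp only [hj, iff_false, not_not, β]
      rw [coefExt_apply_notMem _ hj]
  have hmean : ∀ s, meanVec X (β s) =
      meanVec X (coefExt M fun _ => T) + ∑ i, (σ * sgn (s i)) • e i := by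
    intro s
    simp only [β, ← meanVecLin_apply, map_add, map_sum, map_smul]
    simp only [meanVecLin_apply, hu]
  have hflip : ∀ s i, meanVec X (β (Function.update s i true)) =
      meanVec X (β (Function.update s i false)) + (2 * σ) • e i := by
    intro s i
    have h1 : ∑ k, (σ * sgn (Function.update s i true k)) • e k -
        ∑ k, (σ * sgn (Function.update s i false k)) • e k = (2 * σ) • e i := by
      rw [← Finset.sum_sub_distrib, Finset.sum_eq_single i]
      · simp only [Function.update_self, sgn, if_true, Bool.false_eq_true, if_false]
        module
      · intro k _ hk
        simp [hk]
      · simp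
    rw [hmean, hmean, ← h1]
    abel
  let D : Fin d → (Fin d → Bool) → ℝ≥0∞ := fun i s =>
    ∫⁻ x, ENNReal.ofReal ((inner ℝ (e i) (est (meanVec X (β s) + σ • x)) -
      inner ℝ (e i) (meanVec X (β s))) ^ 2) ∂(stdGaussian (EuclideanSpace ℝ (Fin n)))
  have hD : ∀ i s, ENNReal.ofReal (2 * gaussianPDFReal 0 1 2 * σ ^ 2) ≤
      D i (Function.update s i true) + D i (Function.update s i false) := by
    intro i s
    -- `w` is the midpoint of the edge, so its endpoints are `w ± σ • e i`.
    set w := meanVec X (β (Function.update s i false)) + σ • e i with hw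
    have h1 : meanVec X (β (Function.update s i false)) = w - σ • e i := by rw [hw]; abel
    have h2 : meanVec X (β (Function.update s i true)) = w + σ • e i := by
      rw [hflip, hw]; module
    have key := two_point_bound (hb.1 i) hσ (f := fun y => inner ℝ (e i) (est y))
      (by fun_prop) w (inner ℝ (e i) w)
    simp only [D, h1, h2]
    simpa [inner_add_right, inner_sub_right, inner_smul_right, hb.1 i] using key
  have hrisk : ∀ s, ∑ i, D i s ≤ maxRisk X Ω σ M.card est := by
    intro s
    have hβ : β s ∈ coefSet Ω M.card := by
      refine ⟨?_, ?_⟩ <;> rw [hsupp]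
      exact hM
    refine le_trans ?_ (le_iSup₂_of_le (f := fun β _ => risk X σ est β) (β s) hβ le_rfl)
    rw [risk, lintegral_obsLaw _ _ _ _ (by fun_prop), ← lintegral_finsetSum _ (by fun_prop)]
    refine lintegral_mono fun x => ?_
    rw [← ENNReal.ofReal_sum_of_nonneg (fun _ _ => sq_nonneg _)]
    refine ENNReal.ofReal_le_ofReal ?_
    -- Bessel's inequality: the coordinate losses add up to at most the full loss.
    have := hb.sum_inner_products_le (s := Finset.univ)
      (est (meanVec X (β s) + σ • x) - meanVec X (β s))
    simpa [inner_sub_right] using this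
  have hsum := (hypercube_sum_bound D hD).trans
    (mul_le_mul_right (Finset.sum_le_sum fun s _ => hrisk s) 2)
  rw [Finset.sum_const, Finset.card_univ, nsmul_eq_mul, mul_left_comm 2,
    ENNReal.mul_le_mul_iff_right (by simp) (by simp), Fintype.card_fin, hdM] at hsum
  have h2 : (M.card : ℝ≥0∞) * ENNReal.ofReal (2 * gaussianPDFReal 0 1 2 * σ ^ 2) =
      2 * ENNReal.ofReal (gaussianPDFReal 0 1 2 * (σ ^ 2 * M.card)) := by
    have hp := gaussianPDFReal_nonneg 0 1 2
    rw [← ENNReal.ofReal_natCast, ← ENNReal.ofReal_ofNat 2,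
      ← ENNReal.ofReal_mul (by positivity), ← ENNReal.ofReal_mul (by positivity)]
    congr 1
    ring
  rwa [h2, ENNReal.mul_le_mul_iff_right (by simp) (by simp)] at hsum

lemma IsSetting.le_minimaxRisk {X : Matrix (Fin n) (Fin p) ℝ} {Ω : Finset (Finset (Fin p))}
    (h : IsSetting X Ω) {σ : ℝ} (hσ : 0 < σ) {p₀ : ℕ} (hp₀ : 0 < numModels Ω p₀) :
    ENNReal.ofReal (gaussianPDFReal 0 1 2 * (σ ^ 2 * p₀)) ≤ minimaxRisk X Ω σ p₀ := by
  obtain ⟨M, hM⟩ := Finset.card_pos.1 hp₀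
  obtain ⟨hMΩ, rfl⟩ := Finset.mem_filter.1 hM
  exact le_iInf₂ fun est hest => h.le_maxRisk hMΩ hσ hest

end LowerBound

/-! ### An oracle inequality for penalized model selection. -/

section Selection

lemma finrank_modelSpace_sup_le (X : Matrix (Fin n) (Fin p) ℝ) (M N : Finset (Fin p)) :
    Module.finrank ℝ ↥(modelSpace X M ⊔ modelSpace X N) ≤ M.card + N.card :=
  (Submodule.finrank_add_le_finrank_add_finrank _ _).trans
    (add_le_add (finrank_modelSpace_le X M) (finrank_modelSpace_le X N))

/-- The basic inequality for a penalized least squares selector. -/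
lemma IsSetting.norm_selectedEstimate_sub_sq_le {X : Matrix (Fin n) (Fin p) ℝ}
    {Ω : Finset (Finset (Fin p))} (h : IsSetting X Ω) {σ a : ℝ} (ha : 0 < a)
    {P : Finset (Fin p) → ℝ} {M M₀ : Finset (Fin p)} (hM₀ : M₀ ∈ Ω)
    {μ x : EuclideanSpace ℝ (Fin n)} (hμ : μ ∈ modelSpace X M₀)
    (hle : ‖(μ + σ • x) - meanVec X (lsCoef X M (μ + σ • x))‖ ^ 2 + P M ≤
      ‖(μ + σ • x) - meanVec X (lsCoef X M₀ (μ + σ • x))‖ ^ 2 + P M₀) :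
    (1 - a) * ‖meanVec X (lsCoef X M (μ + σ • x)) - μ‖ ^ 2 ≤
      σ ^ 2 / a * ‖(modelSpace X M ⊔ modelSpace X M₀).orthogonalProjectionOnto x‖ ^ 2 +
        P M₀ - P M := by
  set V := modelSpace X M ⊔ modelSpace X M₀
  have h1 := hle.trans
    (add_le_add_left (h.norm_residual_le (h.card_le _ hM₀) (μ + σ • x) hμ) (P M₀))
  have hd : meanVec X (lsCoef X M (μ + σ • x)) - μ ∈ V :=
    V.sub_mem (Submodule.mem_sup_left (meanVec_lsCoef_mem_modelSpace X M _))
      (Submodule.mem_sup_right hμ)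
  generalize hdd : meanVec X (lsCoef X M (μ + σ • x)) - μ = d at hd ⊢
  rw [show (μ + σ • x) - meanVec X (lsCoef X M (μ + σ • x)) = σ • x - d by rw [← hdd]; abel,
    add_sub_cancel_left, norm_sub_sq_real, inner_smul_left] at h1
  have h2 : inner ℝ x d = inner ℝ (V.orthogonalProjectionOnto x) (⟨d, hd⟩ : V) :=
    (Submodule.inner_orthogonalProjectionOnto_eq_of_mem_right (⟨d, hd⟩ : V) x).symm
  have h3 := abs_real_inner_le_norm (V.orthogonalProjectionOnto x) (⟨d, hd⟩ : V)
  rw [← h2, Submodule.coe_norm (⟨d, hd⟩ : V)] at h3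
  generalize ‖V.orthogonalProjectionOnto x‖ = q at h3 ⊢
  -- Since `d` lies in `V`, the noise is seen only through its projection; a weighted AM-GM
  -- inequality then moves `a ‖d‖²` to the left-hand side.
  have h4 : 2 * (σ * inner ℝ x d) ≤ a * ‖d‖ ^ 2 + σ ^ 2 / a * q ^ 2 := by
    have h5 : σ * inner ℝ x d ≤ |σ| * (q * ‖d‖) := by
      refine (le_abs_self _).trans ?_
      rw [abs_mul]
      exact mul_le_mul_of_nonneg_left h3 (abs_nonneg _)
    have h6 : a * ‖d‖ ^ 2 + σ ^ 2 / a * q ^ 2 - 2 * (|σ| * (q * ‖d‖)) =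
        (a * ‖d‖ - |σ| * q) ^ 2 / a := by
      rw [← sq_abs σ]
      field_simp
      ring
    have h7 : 0 ≤ (a * ‖d‖ - |σ| * q) ^ 2 / a := by positivity
    linarith
  simp only [conj_trivial] at h1
  linarith

/-- The risk of a penalized least squares selector: an oracle inequality under a Kraft-type
condition on the penalty. -/
theorem IsSetting.risk_selectedEstimate_le {X : Matrix (Fin n) (Fin p) ℝ}
    {Ω : Finset (Finset (Fin p))} (h : IsSetting X Ω) {σ : ℝ} (hσ : 0 < σ)
    {𝓜 : Finset (Finset (Fin p))} (h𝓜 : 𝓜 ⊆ Ω) {P : Finset (Fin p) → ℝ}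
    {Mhat : EuclideanSpace ℝ (Fin n) → Finset (Fin p)} (hmem : ∀ y, Mhat y ∈ 𝓜)
    (hle : ∀ y, ∀ M ∈ 𝓜, ‖y - meanVec X (lsCoef X (Mhat y) y)‖ ^ 2 + P (Mhat y) ≤
      ‖y - meanVec X (lsCoef X M y)‖ ^ 2 + P M)
    {a b : ℝ} (ha : 0 < a) (ha1 : a < 1) (hb : 0 < b) (hb1 : b < 1)
    (hsum : ∑ M ∈ 𝓜, Real.exp (-(a * b / 2 * (P M / σ ^ 2))) * (√(1 - b))⁻¹ ^ M.card ≤ 1)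
    {M₀ : Finset (Fin p)} (hM₀ : M₀ ∈ 𝓜) (hP : 0 ≤ P M₀) {β : EuclideanSpace ℝ (Fin p)}
    (hβ : meanVec X β ∈ modelSpace X M₀) :
    risk X σ (selectedEstimate X Mhat) β ≤
      ENNReal.ofReal ((1 - a)⁻¹ *
        (P M₀ + σ ^ 2 * (2 / (a * b)) * (M₀.card * Real.log (√(1 - b))⁻¹ + 1))) := by
  set s := (√(1 - b))⁻¹ with hs
  have ha' : 0 < 1 - a := by linarith
  have hs1 : 1 ≤ s := by
    rw [hs, one_le_inv₀ (Real.sqrt_pos.2 (by linarith)), Real.sqrt_le_one]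
    linarith
  have hs0 : 0 < s := by linarith
  -- Chosen so that `exp (-t)` cancels the factor `s ^ M₀.card` contributed by the true model.
  set t := M₀.card * Real.log s with ht
  have ht0 : 0 ≤ t := mul_nonneg (Nat.cast_nonneg _) (Real.log_nonneg hs1)
  have het : Real.exp (-t) = (s ^ M₀.card)⁻¹ := by
    rw [Real.exp_neg, ht, Real.exp_nat_mul, Real.exp_log hs0]
  set W : Finset (Fin p) → EuclideanSpace ℝ (Fin n) → ℝ := fun M x =>
    Real.exp (b / 2 * ‖(modelSpace X M ⊔ modelSpace X M₀).orthogonalProjectionOnto x‖ ^ 2) with hW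
  set c : Finset (Fin p) → ℝ := fun M => Real.exp (-(a * b / 2 * (P M / σ ^ 2))) with hc
  set A := (1 - a)⁻¹ * (P M₀ + σ ^ 2 * (2 / (a * b)) * t) with hA
  set B := (1 - a)⁻¹ * (σ ^ 2 * (2 / (a * b))) with hB
  have hA0 : 0 ≤ A := by positivity
  have hB0 : 0 ≤ B := by positivity
  have hpt : ∀ x, ‖selectedEstimate X Mhat (meanVec X β + σ • x) - meanVec X β‖ ^ 2 ≤
      A + B * (Real.exp (-t) * ∑ M ∈ 𝓜, c M * W M x) := by
    intro x
    set M := Mhat (meanVec X β + σ • x) with hM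
    have h1 := h.norm_selectedEstimate_sub_sq_le (M := M) ha (h𝓜 hM₀) hβ (hle _ M₀ hM₀)
    -- The selected model depends on the noise, so its term is bounded by the sum over all models,
    -- whose expectation is explicit.
    have h2 : c M * W M x ≤ ∑ M ∈ 𝓜, c M * W M x :=
      Finset.single_le_sum (f := fun M => c M * W M x) (fun _ _ => by positivity) (hmem _)
    have h3 : Real.exp (-t) * (c M * W M x) ≤ Real.exp (-t) * ∑ M ∈ 𝓜, c M * W M x :=
      mul_le_mul_of_nonneg_left h2 (Real.exp_nonneg _)
    set q := ‖(modelSpace X M ⊔ modelSpace X M₀).orthogonalProjectionOnto x‖ with hq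
    have h4 : Real.exp (-t) * (c M * W M x) =
        Real.exp (b / 2 * q ^ 2 - a * b / 2 * (P M / σ ^ 2) - t) := by
      simp only [hc, hW]
      rw [← Real.exp_add, ← Real.exp_add]
      congr 1
      ring
    -- Linearization `z ≤ t + exp (z - t)`, which replaces a maximum over models by exponential
    -- moments.
    have h5 := Real.add_one_le_exp (b / 2 * q ^ 2 - a * b / 2 * (P M / σ ^ 2) - t)
    have h6 : b / 2 * q ^ 2 - a * b / 2 * (P M / σ ^ 2) ≤
        t + Real.exp (-t) * ∑ M ∈ 𝓜, c M * W M x := by linarith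
    have h7 : σ ^ 2 / a * q ^ 2 + P M₀ - P M =
        P M₀ + σ ^ 2 * (2 / (a * b)) * (b / 2 * q ^ 2 - a * b / 2 * (P M / σ ^ 2)) := by
      field_simp
      ring
    have h8 := mul_le_mul_of_nonneg_left h6
      (show 0 ≤ σ ^ 2 * (2 / (a * b)) by positivity)
    rw [h7] at h1
    have h9 := mul_le_mul_of_nonneg_left (h1.trans (add_le_add_right h8 (P M₀)))
      (inv_nonneg.2 ha'.le)
    rw [inv_mul_cancel_left₀ ha'.ne'] at h9
    refine h9.trans (le_of_eq ?_)
    rw [hA, hB]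
    ring
  have hint : ∀ M, ∫⁻ x, ENNReal.ofReal (W M x) ∂(stdGaussian (EuclideanSpace ℝ (Fin n))) ≤
      ENNReal.ofReal (s ^ M.card * s ^ M₀.card) := by
    intro M
    rw [lintegral_exp_norm_orthogonalProjectionOnto_sq _ hb1, ← pow_add]
    exact ENNReal.ofReal_le_ofReal (pow_le_pow_right₀ hs1 (finrank_modelSpace_sup_le X M M₀))
  have hWm : ∀ M, Measurable (W M) := fun M => by fun_prop
  calc risk X σ (selectedEstimate X Mhat) β
      -- `lintegral_map_le` asks for no measurability of the integrand, and `Mhat` is arbitrary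
      -- here.
      ≤ ∫⁻ x, ENNReal.ofReal
          (‖selectedEstimate X Mhat (meanVec X β + σ • x) - meanVec X β‖ ^ 2)
          ∂(stdGaussian (EuclideanSpace ℝ (Fin n))) := lintegral_map_le _ _
    _ ≤ ∫⁻ x, (ENNReal.ofReal A + ENNReal.ofReal (B * Real.exp (-t)) *
          ∑ M ∈ 𝓜, ENNReal.ofReal (c M) * ENNReal.ofReal (W M x))
          ∂(stdGaussian (EuclideanSpace ℝ (Fin n))) := by
        refine lintegral_mono fun x => ?_
        refine (ENNReal.ofReal_le_ofReal (hpt x)).trans (ENNReal.ofReal_add_le.trans ?_)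
        rw [← mul_assoc, ENNReal.ofReal_mul (show 0 ≤ B * Real.exp (-t) by positivity),
          ENNReal.ofReal_sum_of_nonneg (fun _ _ => by positivity)]
        refine le_of_eq (congrArg _ (congrArg _ (Finset.sum_congr rfl fun M _ => ?_)))
        exact ENNReal.ofReal_mul (Real.exp_nonneg _)
    _ = ENNReal.ofReal A + ENNReal.ofReal (B * Real.exp (-t)) *
          ∑ M ∈ 𝓜, ENNReal.ofReal (c M) *
            ∫⁻ x, ENNReal.ofReal (W M x) ∂(stdGaussian (EuclideanSpace ℝ (Fin n))) := by
        rw [lintegral_add_left measurable_const, lintegral_const, measure_univ, mul_one,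
          lintegral_const_mul _ (by fun_prop), lintegral_finsetSum _ (by fun_prop)]
        congr 3
        funext M
        rw [lintegral_const_mul _ (by fun_prop)]
    _ ≤ ENNReal.ofReal A + ENNReal.ofReal (B * Real.exp (-t)) *
          ∑ M ∈ 𝓜, ENNReal.ofReal (c M) * ENNReal.ofReal (s ^ M.card * s ^ M₀.card) := by
        gcongr with M _
        exact hint M
    _ = ENNReal.ofReal (A + B * ∑ M ∈ 𝓜, c M * s ^ M.card) := by
        have h1 : ∀ M, ENNReal.ofReal (c M) * ENNReal.ofReal (s ^ M.card * s ^ M₀.card) =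
            ENNReal.ofReal (c M * (s ^ M.card * s ^ M₀.card)) := fun M =>
          (ENNReal.ofReal_mul (Real.exp_nonneg _)).symm
        simp_rw [h1]
        rw [← ENNReal.ofReal_sum_of_nonneg (fun _ _ => by positivity),
          ← ENNReal.ofReal_mul (by positivity), ← ENNReal.ofReal_add hA0 (by positivity), het]
        congr 2
        rw [mul_assoc, Finset.mul_sum]
        congr 1
        refine Finset.sum_congr rfl fun M _ => ?_
        field_simp
    _ ≤ ENNReal.ofReal (A + B * 1) := by gcongr
    _ = _ := by
        rw [hA, hB]
        congr 1
        ring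

/-- A measurable choice of a minimizer among finitely many measurable functions. -/
lemma exists_measurable_argmin {α κ : Type*} [MeasurableSpace α] {S : Finset κ}
    (hS : S.Nonempty) {f : κ → α → ℝ} (hf : ∀ k, Measurable (f k)) :
    ∃ g : α → κ, (∀ k, MeasurableSet {y | g y = k}) ∧ (∀ y, g y ∈ S) ∧
      ∀ y, ∀ k ∈ S, f (g y) y ≤ f k y := by
  induction hS using Finset.Nonempty.cons_induction with
  | singleton k => exact ⟨fun _ => k, fun _ => by simp, by simp, by simp⟩
  | cons k S hk hS ih =>
    obtain ⟨g, hgm, hgS, hgle⟩ := ih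
    have hset : MeasurableSet {y | f k y < f (g y) y} := by
      have : {y | f k y < f (g y) y} = ⋃ j ∈ S, {y | g y = j} ∩ {y | f k y < f j y} := by
        ext y
        simp only [Set.mem_ofPred_eq, Set.mem_iUnion, Set.mem_inter_iff, exists_prop]
        constructor
        · exact fun h => ⟨g y, hgS y, rfl, h⟩
        · rintro ⟨j, _, rfl, h⟩
          exact h
      rw [this]
      exact S.measurableSet_biUnion fun j _ =>
        (hgm j).inter (measurableSet_lt (hf k) (hf j))
    classical
    refine ⟨fun y => if f k y < f (g y) y then k else g y, fun j => ?_, fun y => ?_,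
      fun y j hj => ?_⟩
    · have : {y | (if f k y < f (g y) y then k else g y) = j} =
          ({y | f k y < f (g y) y} ∩ {_y | k = j}) ∪ ({y | f k y < f (g y) y}ᶜ ∩ {y | g y = j}) := by
        ext y
        by_cases h : f k y < f (g y) y <;> simp [h]
      rw [this]
      exact (hset.inter (MeasurableSet.const _)).union (hset.compl.inter (hgm j))
    · dsimp only
      split_ifs
      · exact Finset.mem_cons_self _ _
      · exact Finset.mem_cons_of_mem (hgS y)
    · rcases Finset.mem_cons.1 hj with rfl | hj
      · dsimp only
        split_ifs with h
        · exact le_rfl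
        · exact not_lt.1 h
      · dsimp only
        split_ifs with h
        · exact h.le.trans (hgle y j hj)
        · exact hgle y j hj

end Selection

/-! ### The minimax upper bound, by counting models. -/

section MinimaxUpperBound

lemma numModels_card_pos {Ω : Finset (Finset (Fin p))} {M : Finset (Fin p)} (hM : M ∈ Ω) :
    0 < numModels Ω M.card :=
  Finset.card_pos.2 ⟨M, Finset.mem_filter.2 ⟨hM, rfl⟩⟩

lemma IsSetting.numModels_zero {X : Matrix (Fin n) (Fin p) ℝ} {Ω : Finset (Finset (Fin p))}
    (h : IsSetting X Ω) : numModels Ω 0 = 1 := by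
  rw [numModels, Finset.card_eq_one]
  refine ⟨∅, ?_⟩
  ext M
  simp only [Finset.mem_filter, Finset.card_eq_zero, Finset.mem_singleton]
  exact ⟨fun hM => hM.2, fun hM => ⟨hM ▸ h.null_mem, hM⟩⟩

/-- The growth bound extends to both end sizes because `m(0) = m(r) = 1`. -/
lemma IsSetting.log_numModels_le {X : Matrix (Fin n) (Fin p) ℝ} {Ω : Finset (Finset (Fin p))}
    (h : IsSetting X Ω) {A : ℝ} (hA : 0 ≤ A)
    (hlog : ∀ k : ℕ, 1 ≤ k → k < X.rank → Real.log (numModels Ω k) ≤ A * k) {k : ℕ}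
    (hk : k ≤ X.rank) : Real.log (numModels Ω k) ≤ A * k := by
  rcases Nat.eq_zero_or_pos k with rfl | h0
  · simp [h.numModels_zero]
  · rcases hk.lt_or_eq with hlt | rfl
    · exact hlog k h0 hlt
    · rw [h.saturated, Nat.cast_one, Real.log_one]
      positivity

/-- A sum over models of a function of the model size. -/
lemma sum_models_eq_sum_sizes {Ω : Finset (Finset (Fin p))} {r : ℕ} (hΩ : ∀ M ∈ Ω, M.card ≤ r)
    (f : ℕ → ℝ) : ∑ M ∈ Ω, f M.card = ∑ k ∈ Finset.range (r + 1), numModels Ω k * f k := by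
  rw [← Finset.sum_fiberwise_of_maps_to (g := Finset.card) (t := Finset.range (r + 1))
    (fun M hM => Finset.mem_range_succ_iff.2 (hΩ M hM))]
  refine Finset.sum_congr rfl fun k _ => ?_
  rw [Finset.sum_congr rfl (g := fun _ => f k) fun M hM => by rw [(Finset.mem_filter.1 hM).2],
    Finset.sum_const, nsmul_eq_mul, numModels]

/-- The `p₀ + 1` possible sizes cost only one more factor `exp p₀`. This is the Kraft condition for
a constant penalty. -/
lemma IsSetting.card_models_le {X : Matrix (Fin n) (Fin p) ℝ} {Ω : Finset (Finset (Fin p))}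
    (h : IsSetting X Ω) {A : ℝ} (hA : 0 ≤ A)
    (hlog : ∀ k : ℕ, 1 ≤ k → k < X.rank → Real.log (numModels Ω k) ≤ A * k) {p₀ : ℕ}
    (hp₀ : p₀ ≤ X.rank) :
    ((Ω.filter fun M => M.card ≤ p₀).card : ℝ) ≤ Real.exp ((A + 1) * p₀) := by
  have h1 := sum_models_eq_sum_sizes (Ω := Ω.filter fun M => M.card ≤ p₀) (r := p₀)
    (fun M hM => (Finset.mem_filter.1 hM).2) (fun _ => 1)
  rw [Finset.sum_const, nsmul_one] at h1
  calc ((Ω.filter fun M => M.card ≤ p₀).card : ℝ)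
      ≤ ∑ _k ∈ Finset.range (p₀ + 1), Real.exp (A * p₀) := by
        rw [h1]
        refine Finset.sum_le_sum fun k hk => ?_
        have hk : k ≤ p₀ := Finset.mem_range_succ_iff.1 hk
        have h2 : (numModels (Ω.filter fun M => M.card ≤ p₀) k : ℝ) ≤ numModels Ω k := by
          exact_mod_cast Finset.card_le_card
            (Finset.filter_subset_filter _ (Finset.filter_subset _ _))
        have h3 : (numModels Ω k : ℝ) ≤ Real.exp (A * k) := by
          rcases Nat.eq_zero_or_pos (numModels Ω k) with h0 | h0
          · rw [h0, Nat.cast_zero]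
            positivity
          · rw [← Real.log_le_iff_le_exp (by exact_mod_cast h0)]
            exact h.log_numModels_le hA hlog (hk.trans hp₀)
        rw [mul_one]
        refine (h2.trans h3).trans (Real.exp_le_exp.2 ?_)
        gcongr
    _ = (p₀ + 1) * Real.exp (A * p₀) := by simp
    _ ≤ Real.exp p₀ * Real.exp (A * p₀) := by
        gcongr
        exact Real.add_one_le_exp _
    _ = Real.exp ((A + 1) * p₀) := by
        rw [← Real.exp_add]
        ring_nf

/-- Least squares over the admissible models of size at most `p₀` attains the rate `σ² p₀`. -/
lemma IsSetting.minimaxRisk_le {X : Matrix (Fin n) (Fin p) ℝ} {Ω : Finset (Finset (Fin p))}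
    (h : IsSetting X Ω) {A : ℝ} (hA : 0 ≤ A)
    (hlog : ∀ k : ℕ, 1 ≤ k → k < X.rank → Real.log (numModels Ω k) ≤ A * k) {σ : ℝ} (hσ : 0 < σ)
    {p₀ : ℕ} (h1 : 1 ≤ p₀) (hp₀ : p₀ ≤ X.rank) :
    minimaxRisk X Ω σ p₀ ≤ ENNReal.ofReal ((16 * A + 64) * (σ ^ 2 * p₀)) := by
  have h1' : (1 : ℝ) ≤ p₀ := by exact_mod_cast h1
  obtain ⟨Mhat, hmeas, hmem, hmin⟩ := exists_measurable_argmin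
    (S := Ω.filter fun M => M.card ≤ p₀)
    ⟨∅, Finset.mem_filter.2 ⟨h.null_mem, by simp⟩⟩
    (f := fun M y => ‖y - meanVec X (lsCoef X M y)‖ ^ 2)
    (fun M => by have := measurable_meanVec_lsCoef X M; fun_prop)
  refine (iInf₂_le _ (measurable_selectedEstimate X hmeas)).trans (iSup₂_le fun β hβ => ?_)
  have hs2 : (√(1 - 1 / 2) : ℝ)⁻¹ ≤ 2 := by
    rw [inv_le_comm₀ (Real.sqrt_pos.2 (by norm_num)) two_pos]
    exact Real.le_sqrt_of_sq_le (by norm_num)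
  have hs0 : 0 < (√(1 - 1 / 2) : ℝ)⁻¹ := inv_pos.2 (Real.sqrt_pos.2 (by norm_num))
  have hs1 : 1 ≤ (√(1 - 1 / 2) : ℝ)⁻¹ := by
    rw [one_le_inv₀ (Real.sqrt_pos.2 (by norm_num)), Real.sqrt_le_one]
    norm_num
  refine (h.risk_selectedEstimate_le hσ (Finset.filter_subset _ _)
    -- A constant penalty leaves the minimizer unchanged. With `a * b / 2 = 1 / 8` each Kraft weight
    -- is `exp (-(A + 2) p₀)`: `A + 1` pays for the number of models and `1` for `s ^ M.card`.
    (P := fun _ => 8 * (A + 2) * p₀ * σ ^ 2) hmem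
    (fun y M hM => add_le_add_left (hmin y M hM) _) (a := 1 / 2) (b := 1 / 2)
    (by norm_num) (by norm_num) (by norm_num) (by norm_num) ?_
    (Finset.mem_filter.2 hβ) (by positivity)
    (meanVec_mem_modelSpace X (Finset.Subset.refl _))).trans (ENNReal.ofReal_le_ofReal ?_)
  · have hterm : ∀ M ∈ Ω.filter fun M => M.card ≤ p₀,
        Real.exp (-(1 / 2 * (1 / 2) / 2 * (8 * (A + 2) * p₀ * σ ^ 2 / σ ^ 2))) *
          (√(1 - 1 / 2) : ℝ)⁻¹ ^ M.card ≤ Real.exp (-((A + 1) * p₀)) := by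
      intro M hM
      have h2 : (√(1 - 1 / 2) : ℝ)⁻¹ ^ M.card ≤ Real.exp p₀ := by
        calc (√(1 - 1 / 2) : ℝ)⁻¹ ^ M.card ≤ (√(1 - 1 / 2) : ℝ)⁻¹ ^ p₀ :=
              pow_le_pow_right₀ hs1 (Finset.mem_filter.1 hM).2
          _ ≤ Real.exp 1 ^ p₀ := by
              gcongr
              linarith [Real.add_one_le_exp 1]
          _ = Real.exp p₀ := by rw [← Real.exp_nat_mul, mul_one]
      refine (mul_le_mul_of_nonneg_left h2 (Real.exp_nonneg _)).trans (le_of_eq ?_)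
      rw [mul_div_cancel_right₀ _ (by positivity), ← Real.exp_add]
      congr 1
      ring
    refine (Finset.sum_le_sum hterm).trans ?_
    rw [Finset.sum_const, nsmul_eq_mul, Real.exp_neg]
    exact mul_inv_le_one_of_le₀ (h.card_models_le hA hlog hp₀) (Real.exp_nonneg _)
  · have hc : ((supp β).card : ℝ) ≤ p₀ := by exact_mod_cast hβ.2
    have hl0 := Real.log_nonneg hs1
    have hl1 : Real.log (√(1 - 1 / 2) : ℝ)⁻¹ ≤ 1 := by
      linarith [Real.log_le_sub_one_of_pos hs0]
    have h3 : (supp β).card * Real.log (√(1 - 1 / 2) : ℝ)⁻¹ + 1 ≤ 2 * p₀ := by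
      nlinarith [mul_le_mul hc hl1 hl0 (by positivity)]
    have h4 := mul_le_mul_of_nonneg_left h3 (sq_nonneg σ)
    norm_num at h4 ⊢
    linarith

end MinimaxUpperBound

/-! ### The maximal risk of the MAP estimator. -/

section MAP

variable {X : Matrix (Fin n) (Fin p) ℝ} {Ω : Finset (Finset (Fin p))} {π : ℕ → ℝ}

lemma IsSizePrior.pos {r : ℕ} (hπ : IsSizePrior Ω r π) {k : ℕ} (hk : k ≤ r)
    (hm : 0 < numModels Ω k) : 0 < π k :=
  (hπ.nonneg k hk).lt_of_ne fun h => hm.ne' ((hπ.eq_zero_iff k hk).1 h.symm)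

lemma IsSizePrior.le_one {r : ℕ} (hπ : IsSizePrior Ω r π) {k : ℕ} (hk : k ≤ r) : π k ≤ 1 := by
  rw [← hπ.sum_eq_one]
  exact Finset.single_le_sum (f := π)
    (fun j hj => hπ.nonneg j (Finset.mem_range_succ_iff.1 hj)) (Finset.mem_range_succ_iff.2 hk)

lemma pen_eq {γ σ : ℝ} (hγ : 0 < γ) {k : ℕ} (hm : 0 < numModels Ω k) (hπ : 0 < π k) :
    pen Ω π γ σ k = 2 * σ ^ 2 * (1 + 1 / γ) *
      (Real.log (numModels Ω k) - Real.log (π k) + k / 2 * Real.log (1 + γ)) := by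
  have hm' : (0 : ℝ) < numModels Ω k := by exact_mod_cast hm
  have hg : 0 < 1 + γ := by linarith
  rw [pen, Real.log_mul (by positivity) (by positivity), Real.log_mul (by positivity)
    (by positivity), Real.log_inv, Real.log_rpow hg]
  ring

/-- The upper bound on the prior, read as a lower bound on the complexity `ln (m(k) / π(k))`; size
`0` only needs `m(0) = 1` and `π(0) ≤ 1`. -/
lemma IsSetting.cGamma_mul_le (h : IsSetting X Ω) (hπ : IsSizePrior Ω X.rank π) {γ : ℝ}
    (hupper : ∀ k : ℕ, 1 ≤ k → k ≤ X.rank → 0 < numModels Ω k →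
      π k ≤ (numModels Ω k : ℝ) * Real.exp (-(cGamma γ * k)))
    {k : ℕ} (hk : k ≤ X.rank) (hm : 0 < numModels Ω k) :
    cGamma γ * k ≤ Real.log (numModels Ω k) - Real.log (π k) := by
  rcases Nat.eq_zero_or_pos k with rfl | h0
  · have := Real.log_nonpos (hπ.nonneg 0 hk) (hπ.le_one hk)
    simpa [h.numModels_zero] using this
  · have hm' : (0 : ℝ) < numModels Ω k := by exact_mod_cast hm
    have h1 := Real.log_le_log (hπ.pos hk hm) (hupper k h0 hk hm)
    rw [Real.log_mul hm'.ne' (Real.exp_pos _).ne', Real.log_exp] at h1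
    linarith

/-- The Kraft-type condition for the MAP penalty. -/
lemma IsSetting.sum_exp_neg_pen_le_one (h : IsSetting X Ω) (hπ : IsSizePrior Ω X.rank π)
    {γ σ : ℝ} (hγ : 0 < γ) (hσ : 0 < σ)
    (hupper : ∀ k : ℕ, 1 ≤ k → k ≤ X.rank → 0 < numModels Ω k →
      π k ≤ (numModels Ω k : ℝ) * Real.exp (-(cGamma γ * k))) :
    ∑ M ∈ Ω, Real.exp (-((4 * γ + 2) / (4 * γ + 3) * ((4 * γ + 3) / (4 * γ + 4)) / 2 *
      (pen Ω π γ σ M.card / σ ^ 2))) * (√(1 - (4 * γ + 3) / (4 * γ + 4)))⁻¹ ^ M.card ≤ 1 := by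
  -- With these `a` and `b`, `a b (1 + 1/γ) = 1 + 1/(2γ)` and `s = 2 √(1 + γ)`. The penalty's `(1 +
  -- γ)^{k/2}` cancels that part of `s ^ k`, and the surplus `1/(2γ)` has to pay for `2 ^ k`.
  have hsq : (√(1 - (4 * γ + 3) / (4 * γ + 4)))⁻¹ = √(2 ^ 2 * (1 + γ)) := by
    rw [← Real.sqrt_inv]
    congr 1
    field_simp
    ring
  have hlogs : Real.log (√(2 ^ 2 * (1 + γ))) = Real.log 2 + Real.log (1 + γ) / 2 := by
    rw [Real.log_sqrt (by positivity), Real.log_mul (by positivity) (by positivity), Real.log_pow]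
    push_cast
    ring
  have hs0 : 0 < √(2 ^ 2 * (1 + γ)) := Real.sqrt_pos.2 (by positivity)
  have hterm : ∀ M ∈ Ω, Real.exp (-((4 * γ + 2) / (4 * γ + 3) * ((4 * γ + 3) / (4 * γ + 4)) / 2 *
      (pen Ω π γ σ M.card / σ ^ 2))) * (√(1 - (4 * γ + 3) / (4 * γ + 4)))⁻¹ ^ M.card ≤
      π M.card / numModels Ω M.card := by
    intro M hM
    have hk := h.card_le M hM
    have hm := numModels_card_pos hM
    generalize M.card = k at hk hm ⊢
    have hm' : (0 : ℝ) < numModels Ω k := by exact_mod_cast hm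
    have hp := hπ.pos hk hm
    have hD := h.cGamma_mul_le hπ hupper hk hm
    rw [hsq, pen_eq hγ hm hp, ← Real.exp_log hs0, ← Real.exp_nat_mul, ← Real.exp_add, hlogs,
      ← Real.exp_log (div_pos hp hm'), Real.log_div hp.ne' hm'.ne', Real.exp_le_exp]
    rw [← neg_sub (Real.log (numModels Ω k))]
    generalize Real.log (numModels Ω k) - Real.log (π k) = D at hD ⊢
    have hl : 0 ≤ Real.log (1 + γ) := Real.log_nonneg (by linarith)
    have hpen : (4 * γ + 2) / (4 * γ + 3) * ((4 * γ + 3) / (4 * γ + 4)) / 2 *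
        (2 * σ ^ 2 * (1 + 1 / γ) * (D + k / 2 * Real.log (1 + γ)) / σ ^ 2) =
        D + k / 2 * Real.log (1 + γ) + D / (2 * γ) + k / 2 * Real.log (1 + γ) / (2 * γ) := by
      field_simp
      ring
    -- Here the size of `c(γ)` enters, through `c(γ) ≥ 12 γ ≥ 2 γ ln 2`.
    have hDk : k * Real.log 2 ≤ D / (2 * γ) := by
      rw [le_div_iff₀ (by positivity)]
      refine le_trans ?_ hD
      have h2 : Real.log 2 * (2 * γ) ≤ cGamma γ := by
        rw [cGamma]
        nlinarith [Real.log_two_lt_d9]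
      nlinarith [mul_le_mul_of_nonneg_right h2 (Nat.cast_nonneg (α := ℝ) k)]
    have hrest : 0 ≤ k / 2 * Real.log (1 + γ) / (2 * γ) := by positivity
    rw [hpen]
    linarith
  refine (Finset.sum_le_sum hterm).trans ?_
  rw [sum_models_eq_sum_sizes h.card_le (fun k => π k / numModels Ω k), ← hπ.sum_eq_one]
  refine Finset.sum_le_sum fun k hk => ?_
  rcases Nat.eq_zero_or_pos (numModels Ω k) with h0 | h0
  · rw [h0, Nat.cast_zero, zero_mul]
    exact hπ.nonneg k (Finset.mem_range_succ_iff.1 hk)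
  · rw [mul_div_cancel₀ _ (by exact_mod_cast h0.ne')]

/-- A constant in the bound `C σ² p₀` on the maximal risk of the MAP estimator. -/
def mapConst (A c γ : ℝ) : ℝ :=
  (1 - (4 * γ + 2) / (4 * γ + 3))⁻¹ *
    (2 * (1 + 1 / γ) * (A + c + Real.log (1 + γ) / 2) +
      2 / ((4 * γ + 2) / (4 * γ + 3) * ((4 * γ + 3) / (4 * γ + 4))) *
        (Real.log (√(1 - (4 * γ + 3) / (4 * γ + 4)))⁻¹ + 1))

lemma IsSetting.maxRisk_map_le (h : IsSetting X Ω) {A : ℝ} (hA : 0 ≤ A)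
    (hlog : ∀ k : ℕ, 1 ≤ k → k < X.rank → Real.log (numModels Ω k) ≤ A * k)
    (hπ : IsSizePrior Ω X.rank π) {γ c σ : ℝ} (hγ : 0 < γ) (hc : 0 < c) (hσ : 0 < σ)
    (hbound : ∀ k : ℕ, 1 ≤ k → k ≤ X.rank → 0 < numModels Ω k →
      Real.exp (-(c * k)) ≤ π k ∧ π k ≤ (numModels Ω k : ℝ) * Real.exp (-(cGamma γ * k)))
    {Mhat : EuclideanSpace ℝ (Fin n) → Finset (Fin p)} (hM : IsMAPSelector X Ω π γ σ Mhat)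
    {p₀ : ℕ} (h1 : 1 ≤ p₀) (hm₀ : 0 < numModels Ω p₀) :
    maxRisk X Ω σ p₀ (selectedEstimate X Mhat) ≤
      ENNReal.ofReal (mapConst A c γ * (σ ^ 2 * p₀)) := by
  refine iSup₂_le fun β hβ => ?_
  -- The lower bound on the prior starts at size `1`, so the penalty of the null model is not
  -- controlled. For `β = 0` a model of size `p₀` serves as the comparison, since its space contains
  -- the zero mean.
  obtain ⟨M₀, hM₀, hM₀1, hM₀p, hsub⟩ :
      ∃ M₀ ∈ Ω, 1 ≤ M₀.card ∧ M₀.card ≤ p₀ ∧ supp β ⊆ M₀ := by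
    rcases (supp β).eq_empty_or_nonempty with h0 | h0
    · obtain ⟨M, hM⟩ := Finset.card_pos.1 hm₀
      obtain ⟨hMΩ, hMp⟩ := Finset.mem_filter.1 hM
      exact ⟨M, hMΩ, hMp.symm ▸ h1, hMp.le, by simp [h0]⟩
    · exact ⟨supp β, hβ.1, h0.card_pos, hβ.2, Finset.Subset.refl _⟩
  have hk := h.card_le M₀ hM₀
  have hm := numModels_card_pos hM₀
  have hp := hπ.pos hk hm
  have hD := h.cGamma_mul_le hπ (fun k h1 h2 h3 => (hbound k h1 h2 h3).2) hk hm
  have hm1 : (1 : ℝ) ≤ numModels Ω M₀.card := by exact_mod_cast hm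
  have hl : 0 ≤ Real.log (1 + γ) := Real.log_nonneg (by linarith)
  have hcard : (M₀.card : ℝ) ≤ p₀ := by exact_mod_cast hM₀p
  have h1' : (1 : ℝ) ≤ p₀ := by exact_mod_cast h1
  have hpen0 : 0 ≤ pen Ω π γ σ M₀.card := by
    have h2 := Real.log_nonpos hp.le (hπ.le_one hk)
    have h3 := Real.log_nonneg hm1
    have h4 : 0 ≤ Real.log (numModels Ω M₀.card) - Real.log (π M₀.card) := by linarith
    rw [pen_eq hγ hm hp]
    positivity
  have hpen : pen Ω π γ σ M₀.card ≤
      σ ^ 2 * (2 * (1 + 1 / γ) * (A + c + Real.log (1 + γ) / 2)) * p₀ := by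
    have h2 := h.log_numModels_le hA hlog hk
    have h3 := (Real.le_log_iff_exp_le hp).2 (hbound _ hM₀1 hk hm).1
    rw [pen_eq hγ hm hp]
    calc 2 * σ ^ 2 * (1 + 1 / γ) * (Real.log (numModels Ω M₀.card) - Real.log (π M₀.card) +
          M₀.card / 2 * Real.log (1 + γ))
        ≤ 2 * σ ^ 2 * (1 + 1 / γ) * ((A + c + Real.log (1 + γ) / 2) * M₀.card) := by
          gcongr
          linarith
      _ ≤ 2 * σ ^ 2 * (1 + 1 / γ) * ((A + c + Real.log (1 + γ) / 2) * p₀) := by gcongr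
      _ = _ := by ring
  have ha : 0 < (4 * γ + 2) / (4 * γ + 3) := by positivity
  have ha1 : (4 * γ + 2) / (4 * γ + 3) < 1 := by rw [div_lt_one (by positivity)]; linarith
  have hb : 0 < (4 * γ + 3) / (4 * γ + 4) := by positivity
  have hb1 : (4 * γ + 3) / (4 * γ + 4) < 1 := by rw [div_lt_one (by positivity)]; linarith
  refine (h.risk_selectedEstimate_le hσ (Finset.Subset.refl Ω)
    (P := fun M => pen Ω π γ σ M.card) hM.mem hM.le ha ha1 hb hb1
    (h.sum_exp_neg_pen_le_one hπ hγ hσ fun k h1 h2 h3 => (hbound k h1 h2 h3).2)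
    hM₀ hpen0 (meanVec_mem_modelSpace X hsub)).trans (ENNReal.ofReal_le_ofReal ?_)
  have hs1 : 0 ≤ Real.log (√(1 - (4 * γ + 3) / (4 * γ + 4)))⁻¹ := by
    refine Real.log_nonneg ?_
    rw [one_le_inv₀ (Real.sqrt_pos.2 (by linarith)), Real.sqrt_le_one]
    linarith
  have ha' : 0 < 1 - (4 * γ + 2) / (4 * γ + 3) := by linarith
  have h5 : M₀.card * Real.log (√(1 - (4 * γ + 3) / (4 * γ + 4)))⁻¹ + 1 ≤
      (Real.log (√(1 - (4 * γ + 3) / (4 * γ + 4)))⁻¹ + 1) * p₀ := by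
    nlinarith [mul_le_mul_of_nonneg_right hcard hs1]
  calc _ ≤ (1 - (4 * γ + 2) / (4 * γ + 3))⁻¹ *
        (σ ^ 2 * (2 * (1 + 1 / γ) * (A + c + Real.log (1 + γ) / 2)) * p₀ +
          σ ^ 2 * (2 / ((4 * γ + 2) / (4 * γ + 3) * ((4 * γ + 3) / (4 * γ + 4)))) *
            ((Real.log (√(1 - (4 * γ + 3) / (4 * γ + 4)))⁻¹ + 1) * p₀)) := by
        gcongr
    _ = _ := by
        rw [mapConst]
        ring

lemma mapConst_pos {A c γ : ℝ} (hA : 0 ≤ A) (hc : 0 < c) (hγ : 0 < γ) : 0 < mapConst A c γ := by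
  have ha1 : (4 * γ + 2) / (4 * γ + 3) < 1 := by rw [div_lt_one (by positivity)]; linarith
  have hb1 : (4 * γ + 3) / (4 * γ + 4) < 1 := by rw [div_lt_one (by positivity)]; linarith
  have hb : 0 < (4 * γ + 3) / (4 * γ + 4) := by positivity
  have hl : 0 ≤ Real.log (1 + γ) := Real.log_nonneg (by linarith)
  have hs1 : 0 ≤ Real.log (√(1 - (4 * γ + 3) / (4 * γ + 4)))⁻¹ := by
    refine Real.log_nonneg ?_
    rw [one_le_inv₀ (Real.sqrt_pos.2 (by linarith)), Real.sqrt_le_one]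
    linarith
  have ha' : 0 < 1 - (4 * γ + 2) / (4 * γ + 3) := by linarith
  rw [mapConst]
  positivity

end MAP

end StructuredRegression

end
-- The corollary.
open StructuredRegression in
theorem corollary3 (n p : ℕ → ℕ) (X : ∀ t, Matrix (Fin (n t)) (Fin (p t)) ℝ)
    (Ω : ∀ t, Finset (Finset (Fin (p t))))
    (hset : ∀ t, IsSetting (X t) (Ω t))
    (hrank : Tendsto (fun t => (X t).rank) atTop atTop)
    (hdesign : NearlyOrthogonal X)
    (hsmall : SmallNumbers X Ω) :
    (∃ C₁ C₂ : ℝ, 0 < C₁ ∧ 0 < C₂ ∧ ∀ᶠ t in atTop, ∀ σ : ℝ, 0 < σ →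
      ∀ p₀ : ℕ, 1 ≤ p₀ → p₀ ≤ (X t).rank → 0 < numModels (Ω t) p₀ →
        ENNReal.ofReal (C₁ * (σ ^ 2 * p₀)) ≤ minimaxRisk (X t) (Ω t) σ p₀ ∧
        minimaxRisk (X t) (Ω t) σ p₀ ≤ ENNReal.ofReal (C₂ * (σ ^ 2 * p₀))) ∧
    (∀ γ c : ℝ, 0 < γ → 0 < c → ∃ C : ℝ, 0 < C ∧ ∀ᶠ t in atTop, ∀ σ : ℝ, 0 < σ →
      ∀ π : ℕ → ℝ, IsSizePrior (Ω t) (X t).rank π →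
      (∀ k : ℕ, 1 ≤ k → k ≤ (X t).rank → 0 < numModels (Ω t) k →
        Real.exp (-(c * k)) ≤ π k ∧
        π k ≤ (numModels (Ω t) k : ℝ) * Real.exp (-(cGamma γ * k))) →
      ∀ Mhat : EuclideanSpace ℝ (Fin (n t)) → Finset (Fin (p t)),
        IsMAPSelector (X t) (Ω t) π γ σ Mhat →
        ∀ p₀ : ℕ, 1 ≤ p₀ → p₀ ≤ (X t).rank → 0 < numModels (Ω t) p₀ →
          maxRisk (X t) (Ω t) σ p₀ (selectedEstimate (X t) Mhat) ≤
            ENNReal.ofReal C * minimaxRisk (X t) (Ω t) σ p₀) := by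
  obtain ⟨A, hA⟩ := hsmall
  have hlog : ∀ᶠ t in atTop, ∀ k : ℕ, 1 ≤ k → k < (X t).rank →
      Real.log (numModels (Ω t) k) ≤ max A 0 * k := by
    filter_upwards [hA] with t ht k h1 hk
    exact (ht k h1 hk).trans (mul_le_mul_of_nonneg_right (le_max_left _ _) (Nat.cast_nonneg _))
  have hA0 : 0 ≤ max A 0 := le_max_right _ _
  have hκ : 0 < gaussianPDFReal 0 1 2 := gaussianPDFReal_pos _ _ _ one_ne_zero
  refine ⟨⟨gaussianPDFReal 0 1 2, 16 * max A 0 + 64, hκ, by positivity, ?_⟩,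
    -- The constant is the MAP upper constant over the minimax lower constant; `σ² p₀` cancels.
    fun γ c hγ hc => ⟨mapConst (max A 0) c γ / gaussianPDFReal 0 1 2,
      div_pos (mapConst_pos hA0 hc hγ) hκ, ?_⟩⟩
  · filter_upwards [hlog] with t ht σ hσ p₀ h1 hp₀ hm
    exact ⟨(hset t).le_minimaxRisk hσ hm, (hset t).minimaxRisk_le hA0 ht hσ h1 hp₀⟩
  · filter_upwards [hlog] with t ht σ hσ π hπ hbound Mhat hMhat p₀ h1 hp₀ hm
    refine ((hset t).maxRisk_map_le hA0 ht hπ hγ hc hσ hbound hMhat h1 hm).trans ?_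
    refine le_trans (le_of_eq ?_) (mul_le_mul_right ((hset t).le_minimaxRisk hσ hm) _)
    rw [← ENNReal.ofReal_mul (div_pos (mapConst_pos hA0 hc hγ) hκ).le]
    congr 1
    field_simp
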